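/- Write $\mathbb N=\{1,2,3,\dots\}$. For $g\in\mathbb Z[T]$ let $V_g$ be the set of primes $p$ for which the congruence $g(T)\equiv 0 \pmod p$ has a solution, and call a set of primes a \emph{Frobenius set} if it belongs to the Boolean algebra of sets of primes generated by the sets $V_g$, $g\in\mathbb Z[T]$. For a monic $h\in\mathbb Z[T]$ and $M>0$ let $S(h;M)$ be the set of pairs $(p,f)$ such that $p>M$ is prime, $f\in\mathbb N$, and the reduction of $h$ modulo $p$ has a root in the field $\mathbb F_{p^f}$. **Proposition.** Let $h(T)\in\mathbb Z[T]$ be monic. Then there exists an integer $M_0>0$, depending only on $h$, such that $$S(h;M_0)=\bigcup_{i=1}^r \mathcal P_i\times\mathcal N_i$$ for some $r\in\mathbb N$, where (a) the sets $\mathcal P_1,\dots,\mathcal P_r$ are Frobenius sets and form a partition of the set of primes $p>M_0$ (they are non-empty, pairwise disjoint, and their union is the set of all primes $p>M_0$); (b) each $\mathcal N_i$ is a finite (possibly empty) union of sets of the form $k\mathbb N=\{k,2k,3k,\dots\}$ with $k\in\mathbb N$. -/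

import Mathlib

/-- `V_g`: the set of primes `p` for which the congruence `g(T) ≡ 0 (mod p)` has a solution. -/
def primesWithRoot (g : Polynomial ℤ) : Set Nat.Primes :=
  {p | ∃ t : ℤ, g.eval t ≡ 0 [ZMOD ((p : ℕ) : ℤ)]}

/-- A set of primes is a Frobenius set if it is in the Boolean algebra (of sets of primes)
generated by the sets `V_g`, where `g` ranges over all polynomials in `ℤ[T]`. -/
def IsFrobeniusSet (P : Set Nat.Primes) : Prop :=
  P ∈ BooleanSubalgebra.closure (Set.range primesWithRoot)

/-- The reduction modulo `p` of `h` has a root in the field with `p ^ f` elements (`1 ≤ f`). -/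
def HasRootInGaloisField (h : Polynomial ℤ) (p : Nat.Primes) (f : ℕ) : Prop :=
  haveI : Fact (p : ℕ).Prime := ⟨p.2⟩
  ∃ x : GaloisField (p : ℕ) f,
    Polynomial.aeval x (h.map (Int.castRingHom (ZMod (p : ℕ)))) = 0

/-- `S(h; M)`: the pairs `(p, f)` with `p > M` prime, `f ≥ 1`, such that the reduction of `h`
modulo `p` has a root in the field with `p ^ f` elements. -/
def rootPairs (h : Polynomial ℤ) (M : ℕ) : Set (Nat.Primes × ℕ) :=
  {x | M < (x.1 : ℕ) ∧ 1 ≤ x.2 ∧ HasRootInGaloisField h x.1 x.2}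

/-- The set `k ℕ = {k, 2k, 3k, …}`, where `ℕ` is the set of positive integers. -/
def positiveMultiples (k : ℕ) : Set ℕ :=
  {m | ∃ n : ℕ, 1 ≤ n ∧ m = k * n}

/-! A root of `h` mod p has degree d ≤ deg h over F_p and lies in F_{p^f} exactly when d ∣ f. Hence
the admissible f depend only on the set D(p) of d ≤ deg h for which there is a root in F_{p^d}, and
the finitely many values of D(p) give the partition.

It remains to see that, for each d and all large p, having a root in F_{p^d} means that some integer
polynomial g has a root mod p. Take for g the resolvent with roots c(t), where t runs over the
d-tuples of roots of `h` among the algebraic integers, and c (`cyclicForm`) is invariant under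
rotation and separates rotation classes. A root y in F_{p^d} gives the tuple (y, y^p, ...), which
Frobenius rotates, so c takes a value in F_p. Conversely, if c(t) reduces into F_p, Frobenius must
act on t as a rotation, so its d-th power fixes the reduced roots. Density theorems are not needed.
-/

/-! ### Roots in finite fields -/

section FiniteFields

open Polynomial

/-- A root of `h` in one extension which is also a root of a polynomial `q` can be transported
to any extension in which `q` splits. -/
theorem exists_common_root_of_splits {F K L : Type*} [Field F] [Field K] [Field L] [Algebra F K]
    [Algebra F L] {q h : F[X]} (hq : q ≠ 0) (hs : (q.map (algebraMap F L)).Splits)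
    {x : K} (hqx : aeval x q = 0) (hhx : aeval x h = 0) :
    ∃ y : L, aeval y q = 0 ∧ aeval y h = 0 := by
  have hint : IsIntegral F x := (isAlgebraic_iff_isIntegral).1 ⟨q, hq, hqx⟩
  have hdvd := minpoly.dvd F x hqx
  have hs' : ((minpoly F x).map (algebraMap F L)).Splits :=
    hs.of_dvd (Polynomial.map_ne_zero hq) (Polynomial.map_dvd _ hdvd)
  obtain ⟨y, hy⟩ := hs'.exists_eval_eq_zero (by
    rw [degree_map]; exact (minpoly.degree_pos hint).ne')
  have hy' : aeval y (minpoly F x) = 0 := by rwa [aeval_def, ← eval_map]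
  exact ⟨y, aeval_eq_zero_of_dvd_aeval_eq_zero hdvd hy',
    aeval_eq_zero_of_dvd_aeval_eq_zero (minpoly.dvd F x hhx) hy'⟩

theorem hasRootInGaloisField_iff_aeval (h : ℤ[X]) (p : Nat.Primes) [Fact (p : ℕ).Prime] (f : ℕ) :
    HasRootInGaloisField h p f ↔
      ∃ x : GaloisField (p : ℕ) f, aeval x (h.map (algebraMap ℤ (ZMod (p : ℕ)))) = 0 :=
  Iff.rfl

theorem GaloisField.pow_card_pow {p : ℕ} [Fact p.Prime] {f : ℕ} (hf : f ≠ 0) (x : GaloisField p f) :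
    x ^ p ^ f = x := by
  have := Fintype.ofFinite (GaloisField p f)
  rw [← GaloisField.card p f hf, Nat.card_eq_fintype_card, FiniteField.pow_card]

theorem hasRootInGaloisField_of_root (h : ℤ[X]) (p : Nat.Primes) [Fact (p : ℕ).Prime] {f : ℕ}
    (hf : f ≠ 0) {k : Type*} [Field k] [Algebra (ZMod (p : ℕ)) k] {x : k}
    (hx : aeval x h = 0) (hxf : x ^ (p : ℕ) ^ f = x) : HasRootInGaloisField h p f := by
  rw [hasRootInGaloisField_iff_aeval]
  have hq : (X ^ (p : ℕ) ^ f - X : (ZMod (p : ℕ))[X]) ≠ 0 :=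
    FiniteField.X_pow_card_pow_sub_X_ne_zero _ hf p.2.one_lt
  obtain ⟨y, -, hy⟩ := exists_common_root_of_splits (L := GaloisField (p : ℕ) f)
    (h := h.map (algebraMap ℤ (ZMod (p : ℕ)))) hq
    (SplittingField.splits (X ^ (p : ℕ) ^ f - X : (ZMod (p : ℕ))[X])) (x := x) (by simp [hxf]) (by rwa [aeval_map_algebraMap])
  exact ⟨y, hy⟩

theorem HasRootInGaloisField.exists_root {h : ℤ[X]} (hm : h.Monic) {p : Nat.Primes}
    [Fact (p : ℕ).Prime]
    {f : ℕ} (hf : f ≠ 0) (H : HasRootInGaloisField h p f) {k : Type*} [Field k]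
    [Algebra (ZMod (p : ℕ)) k] (hs : (h.map (algebraMap ℤ k)).Splits) :
    ∃ y : k, aeval y h = 0 ∧ y ^ (p : ℕ) ^ f = y := by
  rw [hasRootInGaloisField_iff_aeval] at H
  obtain ⟨x, hx⟩ := H
  obtain ⟨y, hy, hy'⟩ := exists_common_root_of_splits (L := k)
    (h := (X ^ (p : ℕ) ^ f - X : (ZMod (p : ℕ))[X])) (hm.map _).ne_zero
    (by rwa [Polynomial.map_map, ← IsScalarTower.algebraMap_eq]) hx
    (by simp [GaloisField.pow_card_pow hf])
  rw [aeval_map_algebraMap] at hy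
  exact ⟨y, hy, by simpa [sub_eq_zero] using hy'⟩

theorem pow_pow_eq_self_of_dvd {M : Type*} [Monoid M] {x : M} {q d f : ℕ} (hdf : d ∣ f)
    (hx : x ^ q ^ d = x) : x ^ q ^ f = x := by
  obtain ⟨m, rfl⟩ := hdf
  induction m with
  | zero => simp
  | succ m ih => rw [mul_add, mul_one, pow_add, pow_mul, ih, hx]

theorem HasRootInGaloisField.of_dvd {h : ℤ[X]} {p : Nat.Primes} {d f : ℕ} (hf : f ≠ 0)
    (hdf : d ∣ f) (H : HasRootInGaloisField h p d) : HasRootInGaloisField h p f := by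
  have : Fact (p : ℕ).Prime := ⟨p.2⟩
  have hd : d ≠ 0 := fun h0 => hf (by simpa [h0] using hdf)
  rw [hasRootInGaloisField_iff_aeval] at H
  obtain ⟨x, hx⟩ := H
  rw [aeval_map_algebraMap] at hx
  exact hasRootInGaloisField_of_root h p hf hx
    (pow_pow_eq_self_of_dvd hdf (GaloisField.pow_card_pow hd x))

/-- Take for d the degree of the minimal polynomial of the root: that polynomial divides `h` mod p,
and the root generates a subfield with p^d elements. -/
theorem HasRootInGaloisField.exists_dvd_le_natDegree {h : ℤ[X]} (hm : h.Monic) {p : Nat.Primes}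
    {f : ℕ} (hf : f ≠ 0) (H : HasRootInGaloisField h p f) :
    ∃ d, 1 ≤ d ∧ d ≤ h.natDegree ∧ d ∣ f ∧ HasRootInGaloisField h p d := by
  have : Fact (p : ℕ).Prime := ⟨p.2⟩
  rw [hasRootInGaloisField_iff_aeval] at H
  obtain ⟨x, hx⟩ := H
  have hint : IsIntegral (ZMod (p : ℕ)) x := Algebra.IsIntegral.isIntegral x
  have hd := minpoly.natDegree_pos hint
  refine ⟨(minpoly (ZMod (p : ℕ)) x).natDegree, hd, ?_, ?_, ?_⟩
  · rw [← hm.natDegree_map (algebraMap ℤ (ZMod (p : ℕ)))]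
    exact natDegree_le_of_dvd (minpoly.dvd _ _ hx) (hm.map _).ne_zero
  · simpa [GaloisField.finrank (p : ℕ) hf] using minpoly.degree_dvd hint
  · rw [aeval_map_algebraMap] at hx
    refine hasRootInGaloisField_of_root h p hd.ne' hx ?_
    let E := IntermediateField.adjoin (ZMod (p : ℕ)) {x}
    have := Fintype.ofFinite E
    have h1 : Fintype.card E = (p : ℕ) ^ (minpoly (ZMod (p : ℕ)) x).natDegree := by
      rw [← IntermediateField.adjoin.finrank hint, FiniteField.pow_finrank_eq_card]
    have h2 := FiniteField.pow_card (⟨x, IntermediateField.mem_adjoin_simple_self _ x⟩ : E)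
    rw [h1] at h2
    exact congrArg Subtype.val h2

end FiniteFields

/-! ### Rotation-invariant forms on tuples -/

section CyclicForms

open Polynomial

/-- The product over all rotations `j` of `a - ∑ i, t (i + j) * b ^ i`. -/
def cyclicForm {A : Type*} [CommRing A] {d : ℕ} [NeZero d] (a b : ℕ) (t : ZMod d → A) : A :=
  ∏ j : ZMod d, ((a : A) - ∑ i : ZMod d, t (i + j) * (b : A) ^ i.val)

theorem map_cyclicForm {A B F : Type*} [CommRing A] [CommRing B] [FunLike F A B]
    [RingHomClass F A B] (φ : F) {d : ℕ} [NeZero d] (a b : ℕ) (t : ZMod d → A) :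
    φ (cyclicForm a b t) = cyclicForm a b (φ ∘ t) := by
  simp [cyclicForm]

theorem cyclicForm_rotate {A : Type*} [CommRing A] {d : ℕ} [NeZero d] (a b : ℕ) (t : ZMod d → A)
    (s : ZMod d) : cyclicForm a b (fun i => t (i + s)) = cyclicForm a b t := by
  unfold cyclicForm
  rw [← Equiv.prod_comp (Equiv.addRight s) fun j => (a : A) - ∑ i, t (i + j) * (b : A) ^ i.val]
  simp [add_assoc]

theorem exists_natCast_eval_ne_zero {A ι : Type*} [CommRing A] [IsDomain A] [CharZero A]
    (s : Finset ι) (q : ι → A[X]) (hq : ∀ i ∈ s, q i ≠ 0) :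
    ∃ n : ℕ, ∀ i ∈ s, (q i).eval (n : A) ≠ 0 := by
  have h0 : ∏ i ∈ s, q i ≠ 0 := Finset.prod_ne_zero_iff.2 hq
  by_contra! H
  refine h0 (eq_zero_of_infinite_isRoot _ ((Set.infinite_range_of_injective
    (Nat.cast_injective (R := A))).mono ?_))
  rintro _ ⟨n, rfl⟩
  obtain ⟨i, hi, h⟩ := H n
  simp only [Set.mem_ofPred_eq, IsRoot.def, eval_prod]
  exact Finset.prod_eq_zero hi h

/-- `cyclicForm a b t` is the value at a of the polynomial whose roots are the numbers ∑ tᵢ bⁱ, over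
the rotations of t. Finitely many nonzero polynomials have a common non-root in ℕ, so b can separate
tuples and a can separate these polynomials. -/
theorem exists_cyclicForm_separating {A : Type*} [CommRing A] [IsDomain A] [CharZero A] {d : ℕ}
    [NeZero d] (T : Finset (ZMod d → A)) (hT : ∀ t ∈ T, ∀ s, (fun i => t (i + s)) ∈ T) :
    ∃ a b : ℕ, ∀ t ∈ T, ∀ t' ∈ T, cyclicForm a b t = cyclicForm a b t' →
      ∃ s, t = fun i => t' (i + s) := by
  classical
  let P : (ZMod d → A) → A[X] := fun t => ∑ i : ZMod d, C (t i) * X ^ i.val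
  have hP : Function.Injective P := by
    intro t t' h
    ext i
    have := congrArg (fun q => coeff q i.val) h
    simpa [P, finsetSum_coeff, coeff_C_mul, coeff_X_pow, (ZMod.val_injective d).eq_iff]
      using this
  obtain ⟨b, hb⟩ := exists_natCast_eval_ne_zero ((T ×ˢ T).filter fun x => x.1 ≠ x.2)
    (fun x => P x.1 - P x.2) (by
      intro x hx
      simpa [sub_eq_zero, hP.eq_iff] using (Finset.mem_filter.1 hx).2)
  let e : (ZMod d → A) → A := fun t => ∑ i : ZMod d, t i * (b : A) ^ i.val
  have he : ∀ t ∈ T, ∀ t' ∈ T, e t = e t' → t = t' := by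
    intro t ht t' ht' h
    by_contra hne
    refine hb (t, t') (by simp [ht, ht', hne]) ?_
    simpa [P, eval_finsetSum, sub_eq_zero] using h
  let Q : (ZMod d → A) → A[X] := fun t => ∏ j : ZMod d, (X - C (e fun i => t (i + j)))
  obtain ⟨a, ha⟩ := exists_natCast_eval_ne_zero ((T ×ˢ T).filter fun x => Q x.1 ≠ Q x.2)
    (fun x => Q x.1 - Q x.2) (by
      intro x hx
      simpa [sub_eq_zero] using (Finset.mem_filter.1 hx).2)
  have hQa : ∀ t, (Q t).eval (a : A) = cyclicForm a b t := fun t => by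
    simp only [Q, eval_prod, eval_sub, eval_X, eval_C]
    rfl
  refine ⟨a, b, fun t ht t' ht' h => ?_⟩
  have hQ : Q t = Q t' := by
    by_contra hne
    refine ha (t, t') (by simp [ht, ht', hne]) ?_
    simpa [hQa, sub_eq_zero] using h
  have h1 : (Q t').eval (e t) = 0 := by
    rw [← hQ]
    simp only [Q, eval_prod]
    exact Finset.prod_eq_zero (Finset.mem_univ 0) (by simp)
  simp only [Q, eval_prod, Finset.prod_eq_zero_iff, Finset.mem_univ, true_and, eval_sub, eval_X,
    eval_C, sub_eq_zero] at h1
  obtain ⟨s, hs⟩ := h1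
  exact ⟨s, he t ht _ (hT t' ht' s) hs⟩

end CyclicForms

/-! ### Algebraic integers and Galois descent -/

section AlgebraicIntegers

open Polynomial

/-- The ring of all algebraic integers. -/
abbrev AlgInt : Type := integralClosure ℤ (AlgebraicClosure ℚ)

instance AlgInt.isAlgebraic_rat : Algebra.IsAlgebraic ℚ (AlgebraicClosure ℚ) :=
  AlgebraicClosure.isAlgebraic ℚ

instance AlgInt.isAlgClosure_rat : IsAlgClosure ℚ (AlgebraicClosure ℚ) :=
  ⟨inferInstance, inferInstance⟩

instance AlgInt.isGalois_rat : IsGalois ℚ (AlgebraicClosure ℚ) where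
  to_normal := IsAlgClosure.normal ℚ _

theorem AlgInt.splits_map {h : ℤ[X]} (hm : h.Monic) : (h.map (algebraMap ℤ AlgInt)).Splits := by
  refine Splits.of_splits_map_of_injective (i := algebraMap AlgInt (AlgebraicClosure ℚ))
    Subtype.val_injective (IsAlgClosed.splits _) fun a ha => ?_
  rw [Polynomial.map_map, ← IsScalarTower.algebraMap_eq] at ha
  have hint : IsIntegral ℤ a := ⟨h, hm, by simpa [eval_map] using isRoot_of_mem_roots ha⟩
  exact ⟨⟨a, hint⟩, rfl⟩

theorem AlgInt.exists_intCast_eq (r : AlgInt) (hr : ∀ σ : AlgInt ≃ₐ[ℤ] AlgInt, σ r = r) :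
    ∃ n : ℤ, algebraMap ℤ AlgInt n = r := by
  have h1 : (r : AlgebraicClosure ℚ) ∈ Set.range (algebraMap ℚ (AlgebraicClosure ℚ)) := by
    rw [InfiniteGalois.mem_range_algebraMap_iff_fixed]
    intro σ
    have := algebraMap_galRestrict_apply ℤ (B := AlgInt) σ r
    rw [hr] at this
    exact this.symm
  obtain ⟨q, hq⟩ := h1
  have h2 : IsIntegral ℤ q := by
    rw [← isIntegral_algebraMap_iff (algebraMap ℚ (AlgebraicClosure ℚ)).injective, hq]
    exact r.2
  obtain ⟨n, rfl⟩ := IsIntegrallyClosed.isIntegral_iff.1 h2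
  refine ⟨n, Subtype.ext ?_⟩
  rw [← hq]
  simp

theorem AlgInt.exists_natCast_dvd {δ : AlgInt} (hδ : δ ≠ 0) : ∃ N : ℕ, N ≠ 0 ∧ δ ∣ (N : AlgInt) := by
  obtain ⟨n, hn, h⟩ := (Algebra.IsIntegral.isIntegral (R := ℤ) δ).isAlgebraic.exists_nonzero_dvd
    (mem_nonZeroDivisors_of_ne_zero hδ)
  refine ⟨n.natAbs, by simpa using hn, ?_⟩
  have h' : δ ∣ (n : AlgInt) := by simpa using h
  rcases Int.natAbs_eq n with e | e
  · rw [e] at h'; simpa using h'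
  · rw [e] at h'; simpa using h'

-- Galois automorphisms permute the tuples of roots and commute with `cyclicForm`, so the
-- coefficients of the product are fixed algebraic integers, hence integers.
open scoped Classical in
theorem AlgInt.exists_intPolynomial_eq_prod (h : ℤ[X]) (d : ℕ) [NeZero d] (a b : ℕ) :
    ∃ g : ℤ[X], g.map (algebraMap ℤ AlgInt) =
      ∏ t ∈ Fintype.piFinset fun _ : ZMod d => (h.map (algebraMap ℤ AlgInt)).roots.toFinset,
        (X - C (cyclicForm a b t)) := by
  set S := (h.map (algebraMap ℤ AlgInt)).roots.toFinset with hS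
  set G := ∏ t ∈ Fintype.piFinset fun _ : ZMod d => S, (X - C (cyclicForm a b t)) with hG
  have hmem : ∀ (σ : AlgInt ≃ₐ[ℤ] AlgInt) x, x ∈ S → σ x ∈ S := by
    intro σ x hx
    simp only [hS, Multiset.mem_toFinset, mem_roots', IsRoot.def, eval_map_algebraMap] at hx ⊢
    exact ⟨hx.1, by rw [aeval_algHom_apply σ, hx.2, map_zero]⟩
  have hfix : ∀ σ : AlgInt ≃ₐ[ℤ] AlgInt, G.map (σ : AlgInt →+* AlgInt) = G := by
    intro σ
    rw [hG, Polynomial.map_prod]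
    refine Finset.prod_bij' (fun t _ => σ ∘ t) (fun t _ => σ.symm ∘ t) ?_ ?_ ?_ ?_ ?_
    · intro t ht
      rw [Fintype.mem_piFinset] at ht ⊢
      exact fun i => hmem σ _ (ht i)
    · intro t ht
      rw [Fintype.mem_piFinset] at ht ⊢
      exact fun i => hmem σ.symm _ (ht i)
    · intro t _; ext; simp
    · intro t _; ext; simp
    · intro t _
      simp only [Polynomial.map_sub, map_X, map_C, ← map_cyclicForm]
      rfl
  have : G ∈ lifts (algebraMap ℤ AlgInt) := by
    rw [lifts_iff_coeff_lifts]
    intro n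
    refine AlgInt.exists_intCast_eq _ fun σ => ?_
    have := congrArg (fun q => coeff q n) (hfix σ)
    simpa using this
  exact this

end AlgebraicIntegers

/-! ### The resolvent criterion for a root in the field with p^d elements -/

section Resolvent

open Polynomial

/-- If `g` is the product of `X - cyclicForm t` over all tuples `t` of roots of `h`, and the values of
`cyclicForm` modulo a prime above `p` separate the rotation classes of tuples, then `h` has a root
in the field with `p ^ d` elements exactly when `g` has a root modulo `p`. -/
theorem hasRootInGaloisField_iff_of_prod {k R : Type*} [Field k] [CommRing R] [IsDomain R]
    {h g : ℤ[X]} (hm : h.Monic)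
    (hs : (h.map (algebraMap ℤ R)).Splits) (p : Nat.Primes) [Fact (p : ℕ).Prime]
    [Algebra (ZMod (p : ℕ)) k] (π : R →+* k) {d : ℕ} [NeZero d] {a b : ℕ}
    (T : Finset (ZMod d → R))
    (hT : ∀ t, t ∈ T ↔ ∀ i, aeval (t i) h = 0)
    (hg : g.map (algebraMap ℤ R) = ∏ t ∈ T, (X - C (cyclicForm a b t)))
    (hsep : ∀ t ∈ T, ∀ t' ∈ T, π (cyclicForm a b t) = π (cyclicForm a b t') →
      ∃ s, t = fun i => t' (i + s)) :
    HasRootInGaloisField h p d ↔ p ∈ primesWithRoot g := by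
  classical
  have hchar : CharP k (p : ℕ) := charP_of_injective_algebraMap' (ZMod (p : ℕ)) (p : ℕ)
  have hmapπ : π.comp (algebraMap ℤ R) = algebraMap ℤ k := RingHom.ext_int _ _
  have hsk : (h.map (algebraMap ℤ k)).Splits := by
    rw [← hmapπ, ← Polynomial.map_map]
    exact hs.map π
  have hlift : ∀ y : k, aeval y h = 0 → ∃ x : R, aeval x h = 0 ∧ π x = y := by
    intro y hy
    have h1 : h.map (algebraMap ℤ R) =
      ((h.map (algebraMap ℤ R)).roots.map (X - C ·)).prod := hs.eq_prod_roots_of_monic (hm.map _)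
    have h2 : eval y ((h.map (algebraMap ℤ R)).map π) = 0 := by
      rw [Polynomial.map_map, hmapπ, eval_map_algebraMap, hy]
    rw [h1, Polynomial.map_multiset_prod, eval_multiset_prod, Multiset.prod_eq_zero_iff] at h2
    simp only [Multiset.map_map, Multiset.mem_map, Function.comp_apply, Polynomial.map_sub, map_X,
      map_C, eval_sub, eval_X, eval_C, sub_eq_zero] at h2
    obtain ⟨x, hx, hxy⟩ := h2
    exact ⟨x, by rw [← eval_map_algebraMap]; exact isRoot_of_mem_roots hx, hxy.symm⟩
  have hev : ∀ n : ℤ, (g.eval n ≡ 0 [ZMOD ((p : ℕ) : ℤ)]) ↔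
      ∃ t ∈ T, (n : k) = π (cyclicForm a b t) := by
    intro n
    rw [Int.modEq_zero_iff_dvd, ← CharP.intCast_eq_zero_iff k]
    have : ((g.eval n : ℤ) : k) = π ((g.map (algebraMap ℤ R)).eval (n : R)) := by
      have : (g.map (algebraMap ℤ R)).eval ((algebraMap ℤ R) n) = algebraMap ℤ R (g.eval n) :=
        eval_map_apply _ _
      rw [eq_intCast, eq_intCast] at this
      rw [this, map_intCast]
    rw [this, hg, eval_prod, map_prod, Finset.prod_eq_zero_iff]
    simp [sub_eq_zero]
  have hfrob : ∀ n : ℤ, (n : k) ^ (p : ℕ) = n := by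
    intro n
    have := congrArg (algebraMap (ZMod (p : ℕ)) k) (ZMod.pow_card (n : ZMod (p : ℕ)))
    rwa [map_pow, map_intCast] at this
  constructor
  · intro H
    obtain ⟨y, hy, hyd⟩ := H.exists_root hm (NeZero.ne d) hsk
    have hyp : ∀ m : ℕ, aeval (y ^ (p : ℕ) ^ m) h = 0 := by
      intro m
      have := aeval_algHom_apply ((iterateFrobenius k (p : ℕ) m).toIntAlgHom) y h
      rw [hy, map_zero] at this
      simpa [iterateFrobenius_def] using this
    choose t ht using fun i : ZMod d => hlift _ (hyp i.val)
    have htT : t ∈ T := (hT t).2 fun i => (ht i).1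
    have hrot : (frobenius k (p : ℕ)) ∘ (π ∘ t) = fun i => (π ∘ t) (i + 1) := by
      funext i
      simp only [Function.comp_apply, (ht _).2, frobenius_def, ← pow_mul, ← pow_succ]
      rw [ZMod.val_add, ZMod.val_one_eq_one_mod, Nat.add_mod_mod]
      -- Indices wrap around mod d, which is harmless because y is fixed by the d-th power of
      -- Frobenius.
      obtain ⟨q, hq⟩ : ∃ q, i.val + 1 = (i.val + 1) % d + d * q :=
        ⟨_, (Nat.mod_add_div _ _).symm⟩
      conv_lhs => rw [hq, add_comm, pow_add, pow_mul,
        pow_pow_eq_self_of_dvd (dvd_mul_right d q) hyd]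
    have hfix : π (cyclicForm a b t) ^ (p : ℕ) = π (cyclicForm a b t) := by
      rw [← frobenius_def, map_cyclicForm π, map_cyclicForm (frobenius k (p : ℕ)), hrot,
        cyclicForm_rotate]
    -- Elements fixed by Frobenius lie in the prime field, so the value is the image of an integer.
    rw [← Subfield.mem_bot_iff_pow_eq_self, ← ZMod.fieldRange_castHom_eq_bot (p : ℕ)] at hfix
    obtain ⟨z, hz⟩ := hfix
    obtain ⟨n, rfl⟩ := ZMod.intCast_surjective z
    refine ⟨n, (hev n).2 ⟨t, htT, ?_⟩⟩
    rw [← hz]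
    simp
  · rintro ⟨n, hn⟩
    obtain ⟨t, ht, hnt⟩ := (hev n).1 hn
    have hroot : ∀ i, aeval (π (t i) ^ (p : ℕ)) h = 0 := by
      intro i
      have := aeval_algHom_apply (((frobenius k (p : ℕ)).comp π).toIntAlgHom) (t i) h
      rw [(hT t).1 ht i, map_zero] at this
      simpa [frobenius_def] using this
    choose t' ht' using fun i : ZMod d => hlift _ (hroot i)
    have ht'T : t' ∈ T := (hT t').2 fun i => (ht' i).1
    have hcomp : π ∘ t' = frobenius k (p : ℕ) ∘ (π ∘ t) := by
      funext i
      simp [(ht' i).2, frobenius_def]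
    obtain ⟨s, hs'⟩ := hsep t' ht'T t ht (by
      rw [map_cyclicForm π, hcomp, ← map_cyclicForm, ← map_cyclicForm, ← hnt, frobenius_def, hfrob])
    have hstep : ∀ i, π (t i) ^ (p : ℕ) = π (t (i + s)) := by
      intro i
      rw [← (ht' i).2, hs']
    have hiter : ∀ m : ℕ, π (t 0) ^ (p : ℕ) ^ m = π (t (m * s)) := by
      intro m
      induction m with
      | zero => simp
      | succ m ih => rw [pow_succ, pow_mul, ih, hstep]; congr 2; push_cast; ring
    refine hasRootInGaloisField_of_root h p (NeZero.ne d) (x := π (t 0)) ?_ ?_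
    · have := aeval_algHom_apply π.toIntAlgHom (t 0) h
      rw [(hT t).1 ht 0, map_zero] at this
      simpa using this
    -- After d steps the index is d * s = 0 in `ZMod d`.
    · rw [hiter]; simp

theorem exists_primesWithRoot_iff {h : ℤ[X]} (hm : h.Monic) {d : ℕ} (hd : d ≠ 0) :
    ∃ (g : ℤ[X]) (N : ℕ), ∀ p : Nat.Primes, N < (p : ℕ) →
      (HasRootInGaloisField h p d ↔ p ∈ primesWithRoot g) := by
  classical
  have : NeZero d := ⟨hd⟩
  have hm0 : h.map (algebraMap ℤ AlgInt) ≠ 0 := (hm.map _).ne_zero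
  set T := Fintype.piFinset fun _ : ZMod d => (h.map (algebraMap ℤ AlgInt)).roots.toFinset with hT
  have hmem : ∀ t, t ∈ T ↔ ∀ i, aeval (t i) h = 0 := by
    intro t
    simp [hT, Fintype.mem_piFinset, mem_roots', hm0, eval_map_algebraMap]
  obtain ⟨a, b, hab⟩ := exists_cyclicForm_separating T (by
    intro t ht s
    rw [hmem] at ht ⊢
    exact fun i => ht _)
  obtain ⟨g, hg⟩ := AlgInt.exists_intPolynomial_eq_prod h d a b
  set U := (T ×ˢ T).filter fun x => cyclicForm a b x.1 ≠ cyclicForm a b x.2 with hU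
  -- Distinct values of the form stay distinct modulo any prime above p unless p divides N, which p
  -- > N excludes.
  obtain ⟨N, hN0, hN⟩ := AlgInt.exists_natCast_dvd
    (δ := ∏ x ∈ U, (cyclicForm a b x.1 - cyclicForm a b x.2)) (by
      rw [Finset.prod_ne_zero_iff]
      intro x hx
      exact sub_ne_zero.2 (Finset.mem_filter.1 hx).2)
  refine ⟨g, N, fun p hp => ?_⟩
  have hpf : Fact (p : ℕ).Prime := ⟨p.2⟩
  have hmax : (Ideal.span {((p : ℕ) : ℤ)}).IsMaximal :=
    PrincipalIdealRing.isMaximal_of_irreducible (Nat.prime_iff_prime_int.1 p.2).irreducible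
  obtain ⟨Q, hQ, hQp⟩ := Ideal.exists_ideal_over_maximal_of_isIntegral (S := AlgInt)
    (Ideal.span {((p : ℕ) : ℤ)}) (by
      rw [(RingHom.injective_iff_ker_eq_bot _).1 (FaithfulSMul.algebraMap_injective ℤ AlgInt)]
      exact bot_le)
  let _ : Field (AlgInt ⧸ Q) := Ideal.Quotient.field Q
  have hcast : ∀ n : ℤ, ((n : AlgInt ⧸ Q) = 0 ↔ ((p : ℕ) : ℤ) ∣ n) := by
    intro n
    rw [← Ideal.mem_span_singleton, ← hQp, Ideal.mem_comap, eq_intCast,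
      ← Ideal.Quotient.eq_zero_iff_mem, map_intCast]
  have hchar : CharP (AlgInt ⧸ Q) (p : ℕ) := ⟨fun n => by
    have := hcast n
    rw [Int.natCast_dvd_natCast] at this
    simpa using this⟩
  let _ : Algebra (ZMod (p : ℕ)) (AlgInt ⧸ Q) := ZMod.algebra _ _
  refine hasRootInGaloisField_iff_of_prod hm (AlgInt.splits_map hm) p (Ideal.Quotient.mk Q) (a := a) (b := b) T
    hmem hg fun t ht t' ht' htt' => hab t ht t' ht' ?_
  by_contra hne
  have hd1 : cyclicForm a b t - cyclicForm a b t' ∣ (N : AlgInt) :=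
    (Finset.dvd_prod_of_mem (fun x : (ZMod d → AlgInt) × (ZMod d → AlgInt) =>
      cyclicForm a b x.1 - cyclicForm a b x.2)
      (show (t, t') ∈ U by simp [hU, ht, ht', hne])).trans hN
  have hd2 := map_dvd (Ideal.Quotient.mk Q) hd1
  rw [map_sub, htt', sub_self, zero_dvd_iff, map_natCast, CharP.cast_eq_zero_iff _ (p : ℕ)] at hd2
  exact absurd (Nat.le_of_dvd (Nat.pos_of_ne_zero hN0) hd2) (not_le.2 hp)

end Resolvent

/-! ### Frobenius sets and the partition of the primes -/

section FrobeniusSets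

open Polynomial

theorem isFrobeniusSet_primesWithRoot (g : ℤ[X]) : IsFrobeniusSet (primesWithRoot g) :=
  BooleanSubalgebra.subset_closure ⟨g, rfl⟩

theorem IsFrobeniusSet.compl {P : Set Nat.Primes} (hP : IsFrobeniusSet P) : IsFrobeniusSet Pᶜ :=
  BooleanSubalgebra.compl_mem hP

theorem IsFrobeniusSet.inter {P Q : Set Nat.Primes} (hP : IsFrobeniusSet P)
    (hQ : IsFrobeniusSet Q) : IsFrobeniusSet (P ∩ Q) :=
  BooleanSubalgebra.inf_mem hP hQ

theorem isFrobeniusSet_univ : IsFrobeniusSet Set.univ :=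
  BooleanSubalgebra.top_mem

theorem IsFrobeniusSet.biInter {ι : Type*} (s : Finset ι) {P : ι → Set Nat.Primes}
    (hP : ∀ i ∈ s, IsFrobeniusSet (P i)) : IsFrobeniusSet (⋂ i ∈ s, P i) := by
  classical
  induction s using Finset.induction_on with
  | empty => simpa using isFrobeniusSet_univ
  | insert a s _ ih =>
    rw [Finset.set_biInter_insert]
    exact (hP a (Finset.mem_insert_self a s)).inter
      (ih fun i hi => hP i (Finset.mem_insert_of_mem hi))

/-- The constant polynomial M! has a root mod p exactly when p ≤ M. -/
theorem isFrobeniusSet_setOf_lt (M : ℕ) : IsFrobeniusSet {p : Nat.Primes | M < (p : ℕ)} := by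
  have : {p : Nat.Primes | M < (p : ℕ)} = (primesWithRoot (C (M.factorial : ℤ)))ᶜ := by
    ext p
    simp only [primesWithRoot, eval_C, Int.modEq_zero_iff_dvd, Int.natCast_dvd_natCast,
      p.2.dvd_factorial, exists_const, Set.mem_compl_iff, Set.mem_ofPred_eq, not_le]
  rw [this]
  exact (isFrobeniusSet_primesWithRoot _).compl

end FrobeniusSets

theorem exists_bound_isFrobeniusSet {h : Polynomial ℤ} (hm : h.Monic) :
    ∃ M : ℕ, 0 < M ∧ ∀ d ∈ Finset.Icc 1 h.natDegree, ∃ g : Polynomial ℤ, ∀ p : Nat.Primes,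
      M < (p : ℕ) → (HasRootInGaloisField h p d ↔ p ∈ primesWithRoot g) := by
  choose! g N hgN using fun (d : ℕ) (hd : d ≠ 0) => exists_primesWithRoot_iff hm hd
  refine ⟨(Finset.Icc 1 h.natDegree).sup N + 1, Nat.succ_pos _, fun d hd => ⟨g d, fun p hp => ?_⟩⟩
  have hd0 : d ≠ 0 := by have := Finset.mem_Icc.1 hd; omega
  have := Finset.le_sup (f := N) hd
  exact hgN d hd0 p (by omega)

theorem proposition2p4 (h : Polynomial ℤ) (hmonic : h.Monic) :
    ∃ M₀ : ℕ, 0 < M₀ ∧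
      ∃ (r : ℕ) (P : Fin r → Set Nat.Primes) (N : Fin r → Set ℕ),
        rootPairs h M₀ = ⋃ i, P i ×ˢ N i ∧
        -- (a) the `P i` partition the primes bigger than `M₀` into Frobenius sets
        ((∀ i, (P i).Nonempty) ∧
          (∀ i j, i ≠ j → Disjoint (P i) (P j)) ∧
          (⋃ i, P i) = {p : Nat.Primes | M₀ < (p : ℕ)} ∧
          ∀ i, IsFrobeniusSet (P i)) ∧
        -- (b) each `N i` is a finite union of sets `k ℕ` with `k ≥ 1`
        ∀ i, ∃ K : Finset ℕ, (∀ k ∈ K, 1 ≤ k) ∧ N i = ⋃ k ∈ K, positiveMultiples k := by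
  classical
  obtain ⟨M, hM, hfrob⟩ := exists_bound_isFrobeniusSet hmonic
  set I := Finset.Icc 1 h.natDegree with hI
  let D : Nat.Primes → Finset ℕ := fun p => I.filter fun d => HasRootInGaloisField h p d
  let B : Finset ℕ → Set Nat.Primes := fun K => {p | M < (p : ℕ) ∧ D p = K}
  -- Only the values of D attained at primes above M are kept, since the classes must be nonempty.
  let 𝒦 : Finset (Finset ℕ) := I.powerset.filter fun K => (B K).Nonempty
  let e : 𝒦 ≃ Fin 𝒦.card := 𝒦.equivFin
  have hcover : ∀ p : Nat.Primes, M < (p : ℕ) → ∃ i, (e.symm i : Finset ℕ) = D p := by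
    intro p hp
    have hK : D p ∈ 𝒦 :=
      Finset.mem_filter.2 ⟨Finset.mem_powerset.2 (Finset.filter_subset _ _), p, hp, rfl⟩
    exact ⟨e ⟨D p, hK⟩, by simp⟩
  have hK : ∀ i, (e.symm i : Finset ℕ) ⊆ I ∧ (B (e.symm i)).Nonempty := fun i =>
    ⟨Finset.mem_powerset.1 (Finset.mem_filter.1 (e.symm i).2).1,
      (Finset.mem_filter.1 (e.symm i).2).2⟩
  refine ⟨M, hM, 𝒦.card, fun i => B (e.symm i),
    fun i => ⋃ k ∈ (e.symm i : Finset ℕ), positiveMultiples k, ?_,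
    ⟨fun i => (hK i).2, ?_, ?_, ?_⟩,
    fun i => ⟨e.symm i, fun k hk => (Finset.mem_Icc.1 ((hK i).1 hk)).1, rfl⟩⟩
  · ext ⟨p, f⟩
    simp only [rootPairs, Set.mem_ofPred_eq, Set.mem_iUnion, Set.mem_prod, B, positiveMultiples,
      exists_prop]
    constructor
    · rintro ⟨hp, hf, H⟩
      obtain ⟨d, hd1, hdn, ⟨m, rfl⟩, hd⟩ := H.exists_dvd_le_natDegree hmonic (by omega)
      obtain ⟨i, hi⟩ := hcover p hp
      refine ⟨i, ⟨hp, hi.symm⟩, d, ?_, m, Nat.pos_of_ne_zero ?_, rfl⟩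
      · rw [hi]
        exact Finset.mem_filter.2 ⟨Finset.mem_Icc.2 ⟨hd1, hdn⟩, hd⟩
      · rintro rfl
        simp at hf
    · rintro ⟨i, ⟨hp, hi⟩, d, hd, m, hm, rfl⟩
      rw [← hi] at hd
      obtain ⟨hdI, H⟩ := Finset.mem_filter.1 hd
      have hpos : 0 < d * m := Nat.mul_pos (Finset.mem_Icc.1 hdI).1 hm
      exact ⟨hp, hpos, H.of_dvd hpos.ne' (dvd_mul_right d m)⟩
  · intro i j hij
    rw [Set.disjoint_left]
    rintro p ⟨-, hi⟩ ⟨-, hj⟩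
    exact hij (e.symm.injective (Subtype.ext (hi.symm.trans hj)))
  · ext p
    simp only [Set.mem_iUnion, Set.mem_ofPred_eq, B]
    exact ⟨fun ⟨_, hp, _⟩ => hp, fun hp => (hcover p hp).imp fun i hi => ⟨hp, hi.symm⟩⟩
  · intro i
    choose! g hg using hfrob
    set K : Finset ℕ := (e.symm i).1
    have hset : B K = {p : Nat.Primes | M < (p : ℕ)} ∩
        ⋂ d ∈ I, if d ∈ K then primesWithRoot (g d) else (primesWithRoot (g d))ᶜ := by
      ext p
      simp only [B, D, Set.mem_ofPred_eq, Set.mem_inter_iff, Set.mem_iInter]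
      refine and_congr_right fun hp => ?_
      constructor
      · rintro hpK d hd
        split_ifs with h1
        · rw [← hpK, Finset.mem_filter] at h1
          exact (hg d hd p hp).1 h1.2
        · rw [← hpK, Finset.mem_filter] at h1
          exact fun h2 => h1 ⟨hd, (hg d hd p hp).2 h2⟩
      · intro H
        ext d
        rw [Finset.mem_filter]
        constructor
        · rintro ⟨hd, h1⟩
          by_contra hdK
          have := H d hd
          rw [if_neg hdK] at this
          exact this ((hg d hd p hp).1 h1)
        · intro hdK
          have hd := (hK i).1 hdK
          have := H d hd
          rw [if_pos hdK] at this
          exact ⟨hd, (hg d hd p hp).2 this⟩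
    change IsFrobeniusSet (B K)
    rw [hset]
    refine (isFrobeniusSet_setOf_lt M).inter (IsFrobeniusSet.biInter _ fun d _ => ?_)
    split_ifs
    · exact isFrobeniusSet_primesWithRoot _
    · exact (isFrobeniusSet_primesWithRoot _).compl
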